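/- Let $C_n$ denote the cyclic group of order $n$. A subset $D$ of a finite group $\mathcal{G}$ is a $(v,\kappa,\lambda,\mu)$-partial difference set (PDS) if $|\mathcal{G}|=v$, $|D|=\kappa$, every $g\in D$ can be written as $g=d_1d_2^{-1}$ with $(d_1,d_2)\in D\times D$ in exactly $\lambda$ ways, and every $g\in\mathcal{G}\setminus(D\cup\{1\})$ can be so written in exactly $\mu$ ways. Theorem. Let $t\ge 2$ be an integer. For each integer $k$ with $1\le k\le t$ there exists a nonabelian group \[\mathcal{G}\cong (C_4^t\times C_2^{t-k})\rtimes C_2^k\] (a semidirect product with respect to some action of $C_2^k$ on $C_4^t\times C_2^{t-k}$ by automorphisms) that contains a PDS with Denniston parameters, namely a PDS with parameters \[\left(2^{3t},\ (2^{2t-1}-2^{t-1})(2^t-1),\ 2^{t-1}+(2^{2t-1}-2^{t-1})(2^{t-1}-2),\ (2^{2t-1}-2^{t-1})(2^{t-1}-1)\right).\] -/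

import Mathlib

/-- `D` is a `(v, k, l, m)`-partial difference set in the finite group `G`: `|G| = v`, `|D| = k`,
every `g ∈ D` is `d₁ * d₂⁻¹` for exactly `l` pairs `(d₁, d₂) ∈ D × D`, and every nonidentity
`g ∉ D` is so for exactly `m` pairs. -/
structure IsPartialDifferenceSet {G : Type*} [Group G] (D : Set G) (v k l m : ℕ) : Prop where
  finite : Finite G
  card_group : Nat.card G = v
  card_set : D.ncard = k
  card_mem : ∀ g ∈ D, {p : G × G | p.1 ∈ D ∧ p.2 ∈ D ∧ p.1 * p.2⁻¹ = g}.ncard = l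
  card_notMem : ∀ g ∉ D, g ≠ 1 → {p : G × G | p.1 ∈ D ∧ p.2 ∈ D ∧ p.1 * p.2⁻¹ = g}.ncard = m

/-- `Cpow n r` is `C_n ^ r`, the direct product of `r` copies of the cyclic group of order `n`,
written multiplicatively. -/
abbrev Cpow (n r : ℕ) : Type := Fin r → Multiplicative (ZMod n)

/-!
Let `F` be the field of order `q = 2 ^ t` and let `χ` be a nontrivial additive character of `F` with
`χ (s ^ 2) = χ s`. The group `CarryPair F × F`, of order `q ^ 3`, is isomorphic to
`C_4 ^ t × C_2 ^ t`. For `c` in `F` the elements `(⟨w + c w², s⟩, w)` form a subgroup `K c` of order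
`q ^ 2`, and `ψ_c = χ ((c w)³ + c² s)` is a `±1`-valued character of `K c`. For `c ≠ d` the
characters `ψ_c` and `ψ_d` disagree somewhere on `K c ∩ K d`, so their correlation vanishes, and
`f = -∑ c, ψ_c` satisfies `∑ x, f (g x) f x = -q² f g`. Since the `K c` form a spread together with
`N = CarryPair F × 1`, the function `f` is `±1` off `N` and `-q` times the indicator of the identity
on `N`; moreover it has sum `-q` on every coset of `N`. Hence the points off `N` where `f = 1` form
a partial difference set with Denniston parameters.

This set is closed under inverses and the last factor has exponent two, so it is also invariant
under inversion of the other factors. Twisting the multiplication by this inversion changes no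
translate of the set, nor, therefore, the number of representations of any element: the same set is
a partial difference set in the semidirect product with a factor acting by inversion.
-/

section PartialDifferenceSet

variable {G H : Type*} [Group G] [Group H]

theorem ncard_preimage_equiv {α β : Type*} (e : α ≃ β) (s : Set β) :
    (e ⁻¹' s).ncard = s.ncard :=
  congrArg ENat.toNat (Set.encard_preimage_of_bijective e.bijective s)

theorem ncard_mul_inv_eq (D : Set G) (g : G) :
    {p : G × G | p.1 ∈ D ∧ p.2 ∈ D ∧ p.1 * p.2⁻¹ = g}.ncard = {x | g * x ∈ D ∧ x ∈ D}.ncard := by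
  refine Set.ncard_congr (fun p _ => p.2) ?_ ?_ ?_
  · rintro p ⟨h1, h2, rfl⟩
    simpa using ⟨h1, h2⟩
  · rintro ⟨a, b⟩ ⟨c, d⟩ ⟨-, -, h⟩ ⟨-, -, h'⟩ rfl
    simpa [← h'] using h
  · rintro x ⟨h1, h2⟩
    exact ⟨(g * x, x), ⟨h1, h2, by simp⟩, rfl⟩

namespace IsPartialDifferenceSet

variable {v k l m : ℕ}

theorem preimage_of_mul_twisted {S : Set H} (hS : IsPartialDifferenceSet S v k l m) (e : G ≃ H)
    (he : e 1 = 1)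
    (hmul : ∀ g, ∃ σ : H ≃ H, (∀ x, σ x ∈ S ↔ x ∈ S) ∧ ∀ x, e (g * x) = e g * σ (e x)) :
    IsPartialDifferenceSet (e ⁻¹' S) v k l m := by
  have hcount (g : G) : {p : G × G | p.1 ∈ e ⁻¹' S ∧ p.2 ∈ e ⁻¹' S ∧ p.1 * p.2⁻¹ = g}.ncard =
      {p : H × H | p.1 ∈ S ∧ p.2 ∈ S ∧ p.1 * p.2⁻¹ = e g}.ncard := by
    obtain ⟨σ, hσ, hg⟩ := hmul g
    rw [ncard_mul_inv_eq, ncard_mul_inv_eq, ← ncard_preimage_equiv (e.trans σ)]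
    simp [hg, hσ]
  have := hS.finite
  refine ⟨Finite.of_equiv H e.symm, (Nat.card_congr e).trans hS.card_group, ?_, ?_, ?_⟩
  · rw [ncard_preimage_equiv, hS.card_set]
  · exact fun g hg => (hcount g).trans (hS.card_mem _ hg)
  · exact fun g hg h1 => (hcount g).trans (hS.card_notMem _ hg (by rwa [← he, e.injective.ne_iff]))

theorem preimage_mulEquiv {S : Set H} (hS : IsPartialDifferenceSet S v k l m) (e : G ≃* H) :
    IsPartialDifferenceSet (e ⁻¹' S) v k l m :=
  hS.preimage_of_mul_twisted e.toEquiv (map_one e) fun g =>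
    ⟨Equiv.refl H, fun _ => Iff.rfl, map_mul e g⟩

theorem preimage_semidirectProduct {S : Set (G × H)} (hS : IsPartialDifferenceSet S v k l m)
    (φ : H →* MulAut G) (hφ : ∀ b, ∀ x : G × H, (φ b x.1, x.2) ∈ S ↔ x ∈ S) :
    IsPartialDifferenceSet ((SemidirectProduct.equivProd : G ⋊[φ] H ≃ G × H) ⁻¹' S) v k l m :=
  hS.preimage_of_mul_twisted _ rfl fun g =>
    ⟨(φ g.right).toEquiv.prodCongr (Equiv.refl H), hφ g.right, fun _ => rfl⟩

end IsPartialDifferenceSet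

end PartialDifferenceSet

section DennistonFunction

/-- A function on a group of order `q ^ 3` whose values off the subgroup `N` of order `q ^ 2` are
the signs defining a partial difference set of Denniston type. The value `-q` at `1` and the zeros
on the rest of `N` are what makes `f` an eigenvector of its own autocorrelation. -/
structure IsDennistonFunction {G : Type*} [Group G] [Fintype G] (N : Subgroup G)
    [DecidablePred (· ∈ N)] (q : ℕ) (f : G → ℤ) : Prop where
  card_group : Nat.card G = q ^ 3
  card_subgroup : Nat.card N = q ^ 2
  apply_one : f 1 = -q
  apply_of_mem : ∀ g ∈ N, g ≠ 1 → f g = 0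
  apply_of_notMem : ∀ g ∉ N, f g = 1 ∨ f g = -1
  apply_inv : ∀ g, f g⁻¹ = f g
  sum_coset : ∀ g, ∑ n with n ∈ N, f (g * n) = -q
  sum_mul : ∀ g, ∑ x, f (g * x) * f x = -q ^ 2 * f g

/-- The partial difference set of a Denniston function: the points off `N` with sign `1`. -/
def dennistonSet {G : Type*} [Group G] (N : Subgroup G) (f : G → ℤ) : Set G :=
  {g | g ∉ N ∧ f g = 1}

instance {G : Type*} [Group G] (N : Subgroup G) [DecidablePred (· ∈ N)] (f : G → ℤ) :
    DecidablePred (· ∈ dennistonSet N f) :=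
  fun g => inferInstanceAs (Decidable (g ∉ N ∧ f g = 1))

/-- Twice the indicator function of `dennistonSet N f`, written as a combination of functions whose
correlations with each other are known. -/
def dennistonWeight {G : Type*} [Group G] [DecidableEq G] (N : Subgroup G) [DecidablePred (· ∈ N)]
    (q : ℕ) (f : G → ℤ) (g : G) : ℤ :=
  1 - (if g ∈ N then 1 else 0) + f g + if g = 1 then (q : ℤ) else 0

namespace IsDennistonFunction

variable {G : Type*} [Group G] [Fintype G] {N : Subgroup G} [DecidablePred (· ∈ N)] {q : ℕ}
  {f : G → ℤ}

theorem cast_card_group (hf : IsDennistonFunction N q f) : (Fintype.card G : ℤ) = q ^ 3 := by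
  exact_mod_cast Nat.card_eq_fintype_card (α := G) ▸ hf.card_group

theorem cast_card_filter_mem (hf : IsDennistonFunction N q f) :
    (({n | n ∈ N} : Finset G).card : ℤ) = q ^ 2 := by
  rw [← Fintype.card_subtype, ← Nat.card_eq_fintype_card]
  exact_mod_cast hf.card_subgroup

theorem sum_eq (hf : IsDennistonFunction N q f) : ∑ g, f g = -q ^ 2 := by
  have hq : (q : ℤ) ^ 2 ≠ 0 := by
    rw [← hf.cast_card_filter_mem, Nat.cast_ne_zero, Finset.card_ne_zero]
    exact ⟨1, by simp [N.one_mem]⟩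
  have htranslate (n : G) : ∑ g, f (g * n) = ∑ g, f g := Equiv.sum_comp (Equiv.mulRight n) f
  apply mul_left_cancel₀ hq
  calc (q : ℤ) ^ 2 * ∑ g, f g = ∑ n with n ∈ N, ∑ g, f (g * n) := by
        simp only [htranslate, Finset.sum_const, nsmul_eq_mul, hf.cast_card_filter_mem]
    _ = ∑ g, ∑ n with n ∈ N, f (g * n) := Finset.sum_comm
    _ = q ^ 2 * -q ^ 2 := by
        simp only [hf.sum_coset, Finset.sum_const, Finset.card_univ, nsmul_eq_mul,
          hf.cast_card_group]
        ring

theorem sum_mem_mul (hf : IsDennistonFunction N q f) (g : G) :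
    ∑ x, (if g * x ∈ N then 1 else 0) * f x = -q := by
  rw [← hf.sum_coset g⁻¹, ← Equiv.sum_comp (Equiv.mulLeft g⁻¹), Finset.sum_filter]
  simp

section Weight

variable [DecidableEq G]

theorem dennistonWeight_eq_ite (hf : IsDennistonFunction N q f) (g : G) :
    dennistonWeight N q f g = if g ∈ dennistonSet N f then 2 else 0 := by
  by_cases hg : g ∈ N
  · by_cases h1 : g = 1
    · simp [dennistonWeight, dennistonSet, h1, hf.apply_one, N.one_mem]
    · simp [dennistonWeight, dennistonSet, hg, h1, hf.apply_of_mem]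
  · have h1 : g ≠ 1 := fun h => hg (h ▸ N.one_mem)
    rcases hf.apply_of_notMem g hg with h | h <;>
      simp [dennistonWeight, dennistonSet, hg, h1, h]

theorem sum_dennistonWeight (hf : IsDennistonFunction N q f) :
    ∑ g, dennistonWeight N q f g = q * (q - 1) ^ 2 := by
  simp only [dennistonWeight, Finset.sum_add_distrib, Finset.sum_sub_distrib, Finset.sum_const,
    Finset.card_univ, nsmul_eq_mul, hf.cast_card_group, Finset.sum_boole, hf.cast_card_filter_mem,
    hf.sum_eq, Finset.sum_ite_eq', Finset.mem_univ, if_true]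
  ring

theorem sum_coset_dennistonWeight (hf : IsDennistonFunction N q f) (g : G) :
    ∑ n with n ∈ N, dennistonWeight N q f (g * n) =
      (q ^ 2 - q) * (1 - if g ∈ N then 1 else 0) := by
  by_cases hg : g ∈ N
  · rw [if_pos hg, sub_self, mul_zero]
    refine Finset.sum_eq_zero fun n hn => ?_
    rw [hf.dennistonWeight_eq_ite, if_neg]
    exact fun h => h.1 (N.mul_mem hg (Finset.mem_filter.mp hn).2)
  · have hterm : ∀ n ∈ ({n | n ∈ N} : Finset G), dennistonWeight N q f (g * n) = 1 + f (g * n) := by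
      intro n hn
      have hgn : g * n ∉ N := by
        rwa [N.mul_mem_cancel_right (Finset.mem_filter.mp hn).2]
      have h1 : g * n ≠ 1 := fun h => hgn (h ▸ N.one_mem)
      simp [dennistonWeight, hgn, h1]
    rw [Finset.sum_congr rfl hterm, Finset.sum_add_distrib, hf.sum_coset, Finset.sum_const,
      nsmul_one, hf.cast_card_filter_mem, if_neg hg]
    ring

theorem sum_dennistonWeight_mul (hf : IsDennistonFunction N q f) (g : G) :
    ∑ x, dennistonWeight N q f (g * x) * f x = -(q ^ 2 - q) * (1 + f g) := by
  have hone : ∑ x, (if g * x = 1 then (q : ℤ) else 0) * f x = q * f g := by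
    simp [mul_eq_one_iff_inv_eq, hf.apply_inv]
  simp only [dennistonWeight, add_mul, sub_mul, one_mul, Finset.sum_add_distrib,
    Finset.sum_sub_distrib, hf.sum_eq, hf.sum_mem_mul, hf.sum_mul, hone]
  ring

theorem sum_dennistonWeight_mul_dennistonWeight (hf : IsDennistonFunction N q f) (g : G) :
    ∑ x, dennistonWeight N q f (g * x) * dennistonWeight N q f x =
      q * (q - 1) * (q - 3 + (if g ∈ N then 1 else 0) - f g) + q * dennistonWeight N q f g := by
  have hexpand (x : G) : dennistonWeight N q f (g * x) * dennistonWeight N q f x =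
      dennistonWeight N q f (g * x) - (if x ∈ N then dennistonWeight N q f (g * x) else 0) +
        dennistonWeight N q f (g * x) * f x +
        if x = 1 then q * dennistonWeight N q f (g * x) else 0 := by
    rw [dennistonWeight.eq_def N q f x]
    split_ifs <;> ring
  have htranslate : ∑ x, dennistonWeight N q f (g * x) = q * (q - 1) ^ 2 :=
    (Equiv.sum_comp (Equiv.mulLeft g) (dennistonWeight N q f)).trans hf.sum_dennistonWeight
  simp only [hexpand, Finset.sum_add_distrib, Finset.sum_sub_distrib, htranslate,
    ← Finset.sum_filter _ (fun x => dennistonWeight N q f (g * x)), hf.sum_coset_dennistonWeight,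
    hf.sum_dennistonWeight_mul, Finset.sum_ite_eq', Finset.mem_univ, if_true, mul_one]
  ring

end Weight

theorem two_mul_ncard (hf : IsDennistonFunction N q f) :
    2 * ((dennistonSet N f).ncard : ℤ) = q * (q - 1) ^ 2 := by
  classical
  rw [← hf.sum_dennistonWeight, Set.ncard_eq_toFinset_card', Set.toFinset_card,
    Fintype.card_subtype, ← Finset.sum_boole, Finset.mul_sum]
  simp [hf.dennistonWeight_eq_ite]

theorem four_mul_ncard (hf : IsDennistonFunction N q f) (g : G) :
    4 * ({x | g * x ∈ dennistonSet N f ∧ x ∈ dennistonSet N f}.ncard : ℤ) =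
      q * (q - 1) * (q - 3 + (if g ∈ N then 1 else 0) - f g) +
        if g ∈ dennistonSet N f then 2 * (q : ℤ) else 0 := by
  classical
  have hcount := hf.sum_dennistonWeight_mul_dennistonWeight g
  simp only [hf.dennistonWeight_eq_ite] at hcount
  rw [Set.ncard_eq_toFinset_card', Set.toFinset_card, Fintype.card_subtype, ← Finset.sum_boole,
    Finset.mul_sum]
  convert hcount using 2 with x
  · simp only [Set.mem_ofPred_eq]
    split_ifs <;> simp_all
  · split_ifs <;> ring

theorem isPartialDifferenceSet {m : ℕ} (hm : 2 ≤ m) (hf : IsDennistonFunction N (2 * m) f) :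
    IsPartialDifferenceSet (dennistonSet N f) ((2 * m) ^ 3) ((2 * m ^ 2 - m) * (2 * m - 1))
      (m + (2 * m ^ 2 - m) * (m - 2)) ((2 * m ^ 2 - m) * (m - 1)) := by
  obtain ⟨r, rfl⟩ := Nat.exists_eq_add_of_le' hm
  have hblock : 2 * (r + 2) ^ 2 - (r + 2) = (r + 2) * (2 * r + 3) := by
    rw [Nat.sub_eq_iff_eq_add (by nlinarith)]
    ring
  rw [hblock, show 2 * (r + 2) - 1 = 2 * r + 3 by omega, Nat.add_sub_cancel,
    show r + 2 - 1 = r + 1 by omega]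
  refine ⟨inferInstance, hf.card_group, ?_, fun g hg => ?_, fun g hg h1 => ?_⟩
  · have hcard := hf.two_mul_ncard
    zify
    push_cast at hcard
    linarith
  · have hcount := hf.four_mul_ncard g
    rw [if_neg hg.1, if_pos hg, hg.2] at hcount
    rw [ncard_mul_inv_eq]
    zify
    push_cast at hcount
    linarith
  · have hcount := hf.four_mul_ncard g
    have hval : (if g ∈ N then 1 else 0) - f g = 1 := by
      split_ifs with hgN
      · rw [hf.apply_of_mem g hgN h1, sub_zero]
      · rw [(hf.apply_of_notMem g hgN).resolve_left fun h => hg ⟨hgN, h⟩]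
        norm_num
    rw [if_neg hg, add_sub_assoc, hval] at hcount
    rw [ncard_mul_inv_eq]
    zify
    push_cast at hcount
    linarith

theorem isPartialDifferenceSet_two_pow {t : ℕ} (ht : 2 ≤ t)
    (hf : IsDennistonFunction N (2 ^ t) f) :
    IsPartialDifferenceSet (dennistonSet N f) (2 ^ (3 * t))
      ((2 ^ (2 * t - 1) - 2 ^ (t - 1)) * (2 ^ t - 1))
      (2 ^ (t - 1) + (2 ^ (2 * t - 1) - 2 ^ (t - 1)) * (2 ^ (t - 1) - 2))
      ((2 ^ (2 * t - 1) - 2 ^ (t - 1)) * (2 ^ (t - 1) - 1)) := by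
  obtain ⟨s, rfl⟩ := Nat.exists_eq_add_of_le' (Nat.one_le_of_lt ht)
  have hm : 2 ≤ 2 ^ s := Nat.le_self_pow (by omega) 2
  have hexp : 2 * (s + 1) - 1 = 2 * s + 1 := by omega
  have hsq : 2 * (2 ^ s) ^ 2 = 2 ^ (2 * s + 1) := by ring
  rw [pow_succ'] at hf
  have hpds := hf.isPartialDifferenceSet hm
  rw [hsq, ← pow_succ', ← pow_mul, mul_comm (s + 1) 3] at hpds
  rwa [hexp, Nat.add_sub_cancel]

theorem inv_mem_dennistonSet (hf : IsDennistonFunction N q f) {g : G}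
    (hg : g ∈ dennistonSet N f) : g⁻¹ ∈ dennistonSet N f :=
  ⟨fun h => hg.1 (N.inv_mem_iff.mp h), (hf.apply_inv g).trans hg.2⟩

end IsDennistonFunction

end DennistonFunction

section SignCharacter

variable {G : Type*} [Group G]

/-- `ψ` is a homomorphism from `K` to `{1, -1}`, extended by zero to the whole group. -/
structure IsSignCharacterOn (K : Subgroup G) (ψ : G → ℤ) : Prop where
  apply_of_notMem : ∀ g ∉ K, ψ g = 0
  apply_mul_self : ∀ g ∈ K, ψ g * ψ g = 1
  apply_mul_of_mem : ∀ g ∈ K, ∀ h ∈ K, ψ (g * h) = ψ g * ψ h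

namespace IsSignCharacterOn

variable {K L : Subgroup G} {ψ θ : G → ℤ}

theorem apply_mul (hψ : IsSignCharacterOn K ψ) (g : G) {h : G} (hh : h ∈ K) :
    ψ (g * h) = ψ g * ψ h := by
  by_cases hg : g ∈ K
  · exact hψ.apply_mul_of_mem g hg h hh
  · have hgh : g * h ∉ K := by rwa [K.mul_mem_cancel_right hh]
    rw [hψ.apply_of_notMem _ hgh, hψ.apply_of_notMem g hg, zero_mul]

theorem apply_inv (hψ : IsSignCharacterOn K ψ) (g : G) : ψ g⁻¹ = ψ g := by
  by_cases hg : g ∈ K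
  · have hg' := K.inv_mem hg
    calc ψ g⁻¹ = ψ (g * (g⁻¹ * g⁻¹)) := by group
      _ = ψ g * (ψ g⁻¹ * ψ g⁻¹) := by rw [hψ.apply_mul g (K.mul_mem hg' hg'), hψ.apply_mul _ hg']
      _ = ψ g := by rw [hψ.apply_mul_self _ hg', mul_one]
  · rw [hψ.apply_of_notMem g hg, hψ.apply_of_notMem _ fun h => hg (K.inv_mem_iff.mp h)]

variable [Fintype G]

theorem sum_mul_self (hψ : IsSignCharacterOn K ψ) (g : G) :
    ∑ x, ψ (g * x) * ψ x = Nat.card K * ψ g := by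
  classical
  have hterm (x : G) : ψ (g * x) * ψ x = if x ∈ K then ψ g else 0 := by
    split_ifs with hx
    · rw [hψ.apply_mul g hx, mul_assoc, hψ.apply_mul_self x hx, mul_one]
    · rw [hψ.apply_of_notMem x hx, mul_zero]
  simp only [hterm, ← Finset.sum_filter, Finset.sum_const, nsmul_eq_mul,
    Nat.card_eq_fintype_card, Fintype.card_subtype]

theorem sum_mul_eq_zero (hψ : IsSignCharacterOn K ψ) (hθ : IsSignCharacterOn L θ) {z : G}
    (hzK : z ∈ K) (hzL : z ∈ L) (hz : ψ z ≠ θ z) (g : G) : ∑ x, ψ (g * x) * θ x = 0 := by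
  have htranslate : ∑ x, ψ (g * x) * θ x = ψ z * θ z * ∑ x, ψ (g * x) * θ x := by
    rw [Finset.mul_sum]
    refine (Equiv.sum_comp (Equiv.mulRight z) _).symm.trans (Finset.sum_congr rfl fun x _ => ?_)
    rw [Equiv.coe_mulRight, ← mul_assoc, hψ.apply_mul _ hzK, hθ.apply_mul _ hzL]
    ring
  have hne : 1 - ψ z * θ z ≠ 0 := by
    refine fun h => hz (mul_right_cancel₀ (b := θ z) ?_ ?_)
    · exact left_ne_zero_of_mul_eq_one (hθ.apply_mul_self z hzL)
    · rw [hθ.apply_mul_self z hzL]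
      exact (sub_eq_zero.mp h).symm
  refine (mul_eq_zero.mp ?_).resolve_left hne
  rw [sub_mul, one_mul, ← htranslate, sub_self]

theorem sum_mul_sum {ι : Type*} [Fintype ι] {K : ι → Subgroup G} {ψ : ι → G → ℤ} {n : ℕ}
    (hψ : ∀ i, IsSignCharacterOn (K i) (ψ i)) (hcard : ∀ i, Nat.card (K i) = n)
    (hdiff : ∀ i j, i ≠ j → ∃ z, z ∈ K i ∧ z ∈ K j ∧ ψ i z ≠ ψ j z) (g : G) :
    ∑ x, (∑ i, ψ i (g * x)) * ∑ i, ψ i x = n * ∑ i, ψ i g := by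
  have hcorr (i j : ι) (hij : j ≠ i) : ∑ x, ψ i (g * x) * ψ j x = 0 :=
    have ⟨_, hi, hj, hz⟩ := hdiff i j hij.symm
    (hψ i).sum_mul_eq_zero (hψ j) hi hj hz g
  calc ∑ x, (∑ i, ψ i (g * x)) * ∑ i, ψ i x = ∑ i, ∑ j, ∑ x, ψ i (g * x) * ψ j x := by
        simp only [Finset.sum_mul_sum]
        rw [Finset.sum_comm]
        exact Finset.sum_congr rfl fun i _ => Finset.sum_comm
    _ = ∑ i, ∑ x, ψ i (g * x) * ψ i x :=
        Finset.sum_congr rfl fun i _ => Fintype.sum_eq_single i (hcorr i)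
    _ = n * ∑ i, ψ i g := by simp only [(hψ _).sum_mul_self, hcard, Finset.mul_sum]

end IsSignCharacterOn

end SignCharacter

/-- The additive group of Witt vectors of length two over a ring of characteristic two, written
multiplicatively: a low digit `fst` and a high digit `snd`, added with carry. Over the field of
order `2 ^ t` it is isomorphic to `C_4 ^ t`. -/
@[ext]
structure CarryPair (R : Type*) where
  fst : R
  snd : R

namespace CarryPair

section Ring

variable {R : Type*} [CommRing R]

instance : Mul (CarryPair R) := ⟨fun x y => ⟨x.fst + y.fst, x.snd + y.snd + x.fst * y.fst⟩⟩
instance : One (CarryPair R) := ⟨⟨0, 0⟩⟩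
instance : Inv (CarryPair R) := ⟨fun x => ⟨-x.fst, -x.snd + x.fst ^ 2⟩⟩

@[simp] theorem fst_mul (x y : CarryPair R) : (x * y).fst = x.fst + y.fst := rfl
@[simp] theorem snd_mul (x y : CarryPair R) :
    (x * y).snd = x.snd + y.snd + x.fst * y.fst := rfl
@[simp] theorem fst_one : (1 : CarryPair R).fst = 0 := rfl
@[simp] theorem snd_one : (1 : CarryPair R).snd = 0 := rfl
@[simp] theorem fst_inv (x : CarryPair R) : x⁻¹.fst = -x.fst := rfl
@[simp] theorem snd_inv (x : CarryPair R) : x⁻¹.snd = -x.snd + x.fst ^ 2 := rfl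

instance : CommGroup (CarryPair R) where
  mul_assoc x y z := by ext <;> simp only [fst_mul, snd_mul] <;> ring
  one_mul x := by ext <;> simp
  mul_one x := by ext <;> simp
  inv_mul_cancel x := by
    ext <;> simp only [fst_mul, snd_mul, fst_inv, snd_inv, fst_one, snd_one] <;> ring
  mul_comm x y := by ext <;> simp only [fst_mul, snd_mul] <;> ring

end Ring

/-- The pair of digits, forgetting the group structure. -/
def equivProd (R : Type*) : CarryPair R ≃ R × R where
  toFun x := (x.fst, x.snd)
  invFun x := ⟨x.1, x.2⟩

instance {R : Type*} [DecidableEq R] : DecidableEq (CarryPair R) := (equivProd R).decidableEq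

instance {R : Type*} [Fintype R] : Fintype (CarryPair R) := Fintype.ofEquiv _ (equivProd R).symm

theorem natCard_eq (R : Type*) : Nat.card (CarryPair R) = Nat.card R ^ 2 := by
  rw [Nat.card_congr (equivProd R), Nat.card_prod, sq]

theorem sum_eq {R M : Type*} [Fintype R] [AddCommMonoid M] (g : CarryPair R → M) :
    ∑ y, g y = ∑ u, ∑ v, g ⟨u, v⟩ := by
  rw [← Fintype.sum_prod_type', ← (equivProd R).symm.sum_comp]
  rfl

end CarryPair

section SpreadSubgroup

variable {R : Type*} [CommRing R] [CharP R 2]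

theorem addChar_mul_self (χ : AddChar R ℤ) (s : R) : χ s * χ s = 1 := by
  rw [← AddChar.map_add_eq_mul, CharTwo.add_self_eq_zero, AddChar.map_zero_eq_one]

theorem addChar_eq_of_eq_add {χ : AddChar R ℤ} (hsq : ∀ s, χ (s ^ 2) = χ s) {x y r : R}
    (h : x = y + (r ^ 2 + r)) : χ x = χ y := by
  rw [h, AddChar.map_add_eq_mul, AddChar.map_add_eq_mul, hsq, addChar_mul_self, mul_one]

/-- The components of the spread. Over a finite field, modulo the pairs `(⟨0, s⟩, 0)`, these
subgroups and `CarryPair R × 1` partition the nonzero points `(a, w)` of the plane. -/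
def spreadSubgroup (c : R) : Subgroup (CarryPair R × Multiplicative R) where
  carrier := {g | g.1.fst = g.2.toAdd + c * g.2.toAdd ^ 2}
  one_mem' := by simp
  mul_mem' {g h} hg hh := by
    simp only [Set.mem_ofPred_eq, Prod.fst_mul, Prod.snd_mul, CarryPair.fst_mul, toAdd_mul] at *
    rw [hg, hh, CharTwo.add_sq]
    ring
  inv_mem' {g} hg := by simpa [CharTwo.neg_eq] using hg

theorem mem_spreadSubgroup {c : R} {g : CarryPair R × Multiplicative R} :
    g ∈ spreadSubgroup c ↔ g.1.fst = g.2.toAdd + c * g.2.toAdd ^ 2 := Iff.rfl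

/-- A point of `spreadSubgroup c` is determined by its high digit and its last coordinate. -/
def spreadSubgroupEquiv (c : R) : spreadSubgroup c ≃ R × R where
  toFun g := (g.1.1.snd, g.1.2.toAdd)
  invFun p := ⟨(⟨p.2 + c * p.2 ^ 2, p.1⟩, .ofAdd p.2), rfl⟩
  left_inv := by
    rintro ⟨⟨⟨a, s⟩, w⟩, h⟩
    have ha : a = w.toAdd + c * w.toAdd ^ 2 := h
    subst ha
    rfl

theorem natCard_spreadSubgroup (c : R) : Nat.card (spreadSubgroup c) = Nat.card R ^ 2 := by
  rw [Nat.card_congr (spreadSubgroupEquiv c), Nat.card_prod, sq]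

variable [DecidableEq R]

instance (c : R) : DecidablePred (· ∈ spreadSubgroup c) := fun g =>
  inferInstanceAs (Decidable (g.1.fst = g.2.toAdd + c * g.2.toAdd ^ 2))

/-- The sign character on the spread component `spreadSubgroup c`, extended by zero. The cubic term
compensates the carry; this uses the invariance of `χ` under squaring. -/
def spreadSign (χ : AddChar R ℤ) (c : R) (g : CarryPair R × Multiplicative R) : ℤ :=
  if g ∈ spreadSubgroup c then χ ((c * g.2.toAdd) ^ 3 + c ^ 2 * g.1.snd) else 0

variable {χ : AddChar R ℤ}

theorem isSignCharacterOn_spreadSign (hsq : ∀ s, χ (s ^ 2) = χ s) (c : R) :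
    IsSignCharacterOn (spreadSubgroup c) (spreadSign χ c) where
  apply_of_notMem g hg := if_neg hg
  apply_mul_self g hg := by rw [spreadSign, if_pos hg, addChar_mul_self]
  apply_mul_of_mem g hg h hh := by
    rw [spreadSign, spreadSign, spreadSign, if_pos hg, if_pos hh, if_pos (mul_mem hg hh),
      ← AddChar.map_add_eq_mul]
    simp only [Prod.fst_mul, Prod.snd_mul, CarryPair.snd_mul, toAdd_mul,
      mem_spreadSubgroup.mp hg, mem_spreadSubgroup.mp hh]
    refine addChar_eq_of_eq_add hsq (r := c * g.2.toAdd * (c * h.2.toAdd)) ?_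
    linear_combination (2 * c ^ 3 * g.2.toAdd * h.2.toAdd * (g.2.toAdd + h.2.toAdd)) *
      (CharTwo.two_eq_zero : (2 : R) = 0)

/-- The Denniston function of the spread. The sign `-1` keeps the component `c = 0`, whose sign
character is trivial, out of the difference set. -/
def spreadSum [Fintype R] (χ : AddChar R ℤ) (g : CarryPair R × Multiplicative R) : ℤ :=
  -∑ c, spreadSign χ c g

theorem spreadSum_inv [Fintype R] (hsq : ∀ s, χ (s ^ 2) = χ s)
    (g : CarryPair R × Multiplicative R) :
    spreadSum χ g⁻¹ = spreadSum χ g := by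
  simp only [spreadSum, (isSignCharacterOn_spreadSign hsq _).apply_inv]

end SpreadSubgroup

section SpreadSum

variable {F : Type*} [Field F] [DecidableEq F] {χ : AddChar F ℤ}

theorem sum_addChar_mul_sq [Fintype F] (hχ : χ ≠ 1) (c : F) :
    ∑ s, χ (c ^ 2 * s) = if c = 0 then (Fintype.card F : ℤ) else 0 := by
  simp only [mul_comm (c ^ 2), AddChar.sum_mulShift _ (AddChar.IsPrimitive.of_ne_one hχ),
    sq_eq_zero_iff, Nat.cast_ite, Nat.cast_zero]

variable [CharP F 2]

theorem exists_spreadSign_ne (hχ : χ ≠ 1) {c d : F} (hcd : c ≠ d) :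
    ∃ z, z ∈ spreadSubgroup c ∧ z ∈ spreadSubgroup d ∧ spreadSign χ c z ≠ spreadSign χ d z := by
  obtain ⟨s, hs⟩ := AddChar.ne_one_iff.mp hχ
  refine ⟨(⟨0, s / (c + d) ^ 2⟩, 1), by simp [mem_spreadSubgroup], by simp [mem_spreadSubgroup],
    fun h => hs ?_⟩
  have hcd' : c + d ≠ 0 := fun h => hcd (CharTwo.add_eq_zero.mp h)
  have hsplit : s = c ^ 2 * (s / (c + d) ^ 2) + d ^ 2 * (s / (c + d) ^ 2) := by
    rw [← add_mul, ← CharTwo.add_sq, mul_div_cancel₀ _ (pow_ne_zero 2 hcd')]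
  simp only [spreadSign, mem_spreadSubgroup, toAdd_one, ne_eq, OfNat.ofNat_ne_zero,
    not_false_eq_true, zero_pow, mul_zero, add_zero, zero_add, if_true] at h
  rw [hsplit, AddChar.map_add_eq_mul, h, addChar_mul_self]

variable [Fintype F]

theorem sum_addChar_sq_mul (hχ : χ ≠ 1) (hsq : ∀ s, χ (s ^ 2) = χ s) (s : F) :
    ∑ c, χ (c ^ 2 * s) = if s = 0 then (Fintype.card F : ℤ) else 0 := by
  obtain ⟨r, rfl⟩ := FiniteField.isSquare_of_char_two (ringChar.eq F 2) s
  simp only [← sq, ← mul_pow, hsq, AddChar.sum_mulShift _ (AddChar.IsPrimitive.of_ne_one hχ),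
    sq_eq_zero_iff, Nat.cast_ite, Nat.cast_zero]

theorem spreadSum_mk_one (hχ : χ ≠ 1) (hsq : ∀ s, χ (s ^ 2) = χ s) (y : CarryPair F) :
    spreadSum χ (y, 1) = if y = 1 then -(Fintype.card F : ℤ) else 0 := by
  by_cases hfst : y.fst = 0
  · simp [spreadSum, spreadSign, mem_spreadSubgroup, CarryPair.ext_iff, hfst,
      sum_addChar_sq_mul hχ hsq, apply_ite Neg.neg]
  · simp [spreadSum, spreadSign, mem_spreadSubgroup, CarryPair.ext_iff, hfst]

theorem spreadSum_eq_one_or {g : CarryPair F × Multiplicative F} (hg : g.2 ≠ 1) :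
    spreadSum χ g = 1 ∨ spreadSum χ g = -1 := by
  have hw : g.2.toAdd ^ 2 ≠ 0 := pow_ne_zero 2 (by simpa using hg)
  have hmem (c : F) : g ∈ spreadSubgroup c ↔ c = (g.1.fst - g.2.toAdd) / g.2.toAdd ^ 2 := by
    rw [mem_spreadSubgroup, eq_div_iff hw, eq_sub_iff_add_eq', eq_comm]
  simp only [spreadSum, spreadSign, hmem, Finset.sum_ite_eq', Finset.mem_univ, if_true,
    neg_eq_iff_eq_neg, neg_neg]
  exact (mul_self_eq_one_iff.mp (addChar_mul_self χ _)).symm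

theorem sum_spreadSum (hχ : χ ≠ 1) (w : Multiplicative F) :
    ∑ y, spreadSum χ (y, w) = -Fintype.card F := by
  have hc (c : F) : ∑ y : CarryPair F, spreadSign χ c (y, w) =
      if c = 0 then (Fintype.card F : ℤ) else 0 := by
    rw [CarryPair.sum_eq, Finset.sum_comm]
    simp only [spreadSign, mem_spreadSubgroup, Finset.sum_ite_eq', Finset.mem_univ, if_true,
      AddChar.map_add_eq_mul, ← Finset.mul_sum, sum_addChar_mul_sq hχ]
    split_ifs with h <;> simp [h]
  simp only [spreadSum, Finset.sum_neg_distrib]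
  rw [Finset.sum_comm]
  simp [hc]

theorem isDennistonFunction_spreadSum (hχ : χ ≠ 1) (hsq : ∀ s, χ (s ^ 2) = χ s) :
    IsDennistonFunction (MonoidHom.snd (CarryPair F) (Multiplicative F)).ker (Fintype.card F)
      (spreadSum χ) where
  card_group := by
    rw [Nat.card_prod, CarryPair.natCard_eq, Nat.card_congr Multiplicative.toAdd,
      Nat.card_eq_fintype_card]
    ring
  card_subgroup := by
    rw [MonoidHom.ker_snd, Nat.card_congr (Subgroup.prodEquiv _ _).toEquiv, Nat.card_prod,
      Subgroup.card_top, Subgroup.card_bot, mul_one, CarryPair.natCard_eq, Nat.card_eq_fintype_card]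
  apply_one := (spreadSum_mk_one hχ hsq 1).trans (if_pos rfl)
  apply_of_mem := by
    rintro ⟨y, w⟩ hw hne
    obtain rfl : w = 1 := hw
    exact (spreadSum_mk_one hχ hsq y).trans (if_neg fun hy => hne (Prod.ext hy rfl))
  apply_of_notMem g hg := spreadSum_eq_one_or hg
  apply_inv := spreadSum_inv hsq
  sum_coset := by
    rintro ⟨y, w⟩
    have hker (x : CarryPair F) (z : Multiplicative F) :
        (x, z) ∈ (MonoidHom.snd (CarryPair F) (Multiplicative F)).ker ↔ z = 1 := Iff.rfl
    rw [← sum_spreadSum hχ w, ← Equiv.sum_comp (Equiv.mulLeft y), Finset.sum_filter,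
      Fintype.sum_prod_type]
    simp only [hker]
    simp
  sum_mul g := by
    have := IsSignCharacterOn.sum_mul_sum (isSignCharacterOn_spreadSign hsq)
      natCard_spreadSubgroup (fun c d => exists_spreadSign_ne hχ) g
    simp only [spreadSum, neg_mul_neg, this, Nat.card_eq_fintype_card]
    push_cast
    ring

end SpreadSum

section InversionAction

variable {A B : Type*} [CommGroup A] [Group B]

theorem semidirectProduct_not_commutative {N : Type*} [Group N] {φ : B →* MulAut N} {b : B} {a : N}
    (h : φ b a ≠ a) : ¬ ∀ x y : N ⋊[φ] B, x * y = y * x := fun hcomm => h <| by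
  simpa using congrArg SemidirectProduct.left (hcomm (.inr b) (.inl a))

/-- The action of the cyclic group of order two on an abelian group by inversion. -/
def invAction (A : Type*) [CommGroup A] : Multiplicative (ZMod 2) →* MulAut A where
  toFun z := if z = 1 then 1 else MulEquiv.inv A
  map_one' := if_pos rfl
  map_mul' x y := by
    have hcases (z : Multiplicative (ZMod 2)) : z = 1 ∨ z = .ofAdd 1 := by revert z; decide
    have hsq : Multiplicative.ofAdd (1 : ZMod 2) * .ofAdd 1 = 1 := rfl
    have hne : Multiplicative.ofAdd (1 : ZMod 2) ≠ 1 := by decide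
    rcases hcases x with rfl | rfl <;> rcases hcases y with rfl | rfl <;> ext a <;> simp [hsq, hne]

theorem invAction_apply (z : Multiplicative (ZMod 2)) (a : A) :
    invAction A z a = if z = 1 then a else a⁻¹ := by
  rw [invAction, MonoidHom.coe_mk, OneHom.coe_mk, apply_ite (fun σ : MulAut A => σ a)]
  rfl

theorem invAction_mem_iff {S : Set (A × B)} (hS : ∀ x ∈ S, x⁻¹ ∈ S) (hB : ∀ b : B, b⁻¹ = b)
    (z : Multiplicative (ZMod 2)) (x : A × B) : (invAction A z x.1, x.2) ∈ S ↔ x ∈ S := by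
  rw [invAction_apply]
  split_ifs
  · rfl
  · have hx : (x.1⁻¹, x.2) = x⁻¹ := Prod.ext rfl (hB x.2).symm
    rw [hx]
    exact ⟨fun h => inv_inv x ▸ hS _ h, hS x⟩

theorem cpow_two_inv {k : ℕ} (b : Cpow 2 k) : b⁻¹ = b :=
  funext fun i => (by decide : ∀ z : Multiplicative (ZMod 2), z⁻¹ = z) (b i)

theorem exists_cpow_four_prod_inv_ne {t : ℕ} (ht : 0 < t) (H : Type*) [Group H] :
    ∃ a : Cpow 4 t × H, a⁻¹ ≠ a :=
  ⟨(fun _ => .ofAdd 1, 1), fun h => (by decide : (.ofAdd 1 : Multiplicative (ZMod 4))⁻¹ ≠ .ofAdd 1)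
    (congrFun (congrArg Prod.fst h) ⟨0, ht⟩)⟩

end InversionAction

section Isomorphisms

theorem nonempty_cpow_mulEquiv {A : Type*} [CommGroup A] {n r : ℕ} [NeZero n]
    (hA : ∀ a : A, a ^ n = 1) {g : Fin r → A} (hg : Subgroup.closure (Set.range g) = ⊤)
    (hcard : Nat.card A = n ^ r) : Nonempty (Cpow n r ≃* A) := by
  let : Module (ZMod n) (Additive A) := AddCommGroup.zmodModule (n := n) hA
  let ℓ := Fintype.linearCombination (ZMod n) (Additive.ofMul ∘ g)
  have hclosure : AddSubgroup.closure (Set.range (Additive.ofMul ∘ g)) = ⊤ :=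
    (Subgroup.toAddSubgroup_closure (Set.range g)).symm.trans (by rw [hg]; rfl)
  have hsurj : Function.Surjective ℓ := by
    rw [← LinearMap.range_eq_top, Fintype.range_linearCombination, eq_top_iff]
    have hle : AddSubgroup.closure (Set.range (Additive.ofMul ∘ g)) ≤
        (Submodule.span (ZMod n) (Set.range (Additive.ofMul ∘ g))).toAddSubgroup :=
      (AddSubgroup.closure_le _).mpr Submodule.subset_span
    exact fun a _ => hle (hclosure.ge (AddSubgroup.mem_top a))
  have hbij : Function.Bijective ℓ := (Nat.bijective_iff_surjective_and_card ℓ).mpr ⟨hsurj, by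
    simpa using hcard.symm.trans (Nat.card_congr Additive.ofMul)⟩
  exact ⟨(MulEquiv.piMultiplicative _).symm.trans
    (AddEquiv.toMultiplicativeLeft (LinearEquiv.ofBijective ℓ hbij).toAddEquiv)⟩

namespace CarryPair

/-- The low digit, as a homomorphism. -/
def fstHom (R : Type*) [CommRing R] : CarryPair R →* Multiplicative R where
  toFun x := .ofAdd x.fst
  map_one' := rfl
  map_mul' _ _ := rfl

theorem pow_four_eq_one {R : Type*} [CommRing R] [CharP R 2] (y : CarryPair R) : y ^ 4 = 1 := by
  have h2 : (2 : R) = 0 := CharTwo.two_eq_zero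
  ext <;> simp only [pow_succ, pow_zero, one_mul, fst_mul, snd_mul, fst_one, snd_one]
  · linear_combination (2 * y.fst) * h2
  · linear_combination (2 * y.snd + 3 * y.fst ^ 2) * h2

variable {F : Type*} [Field F] [Finite F]

theorem eq_top_of_map_fstHom_eq_top [CharP F 2] {H : Subgroup (CarryPair F)}
    (hH : H.map (fstHom F) = ⊤) : H = ⊤ := by
  have hfst (s : F) : ∃ v, (⟨s, v⟩ : CarryPair F) ∈ H := by
    have hs : Multiplicative.ofAdd s ∈ H.map (fstHom F) := hH ▸ Subgroup.mem_top _
    obtain ⟨y, hy, rfl⟩ := hs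
    exact ⟨y.snd, hy⟩
  have hsnd (s : F) : (⟨0, s⟩ : CarryPair F) ∈ H := by
    obtain ⟨r, rfl⟩ := FiniteField.isSquare_of_char_two (ringChar.eq F 2) s
    obtain ⟨v, hv⟩ := hfst r
    convert mul_mem hv hv using 1
    ext <;> simp [CharTwo.add_self_eq_zero]
  refine eq_top_iff.mpr fun y _ => ?_
  obtain ⟨v, hv⟩ := hfst y.fst
  convert mul_mem hv (hsnd (y.snd - v)) using 1
  ext <;> simp

variable [Algebra (ZMod 2) F]

theorem closure_range_basis {ι : Type*} (b : Module.Basis ι (ZMod 2) F) :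
    Subgroup.closure (Set.range fun i => (⟨b i, 0⟩ : CarryPair F)) = ⊤ := by
  have : CharP F 2 := (Algebra.charP_iff (ZMod 2) F 2).mp inferInstance
  set H := Subgroup.closure (Set.range fun i => (⟨b i, 0⟩ : CarryPair F))
  apply eq_top_of_map_fstHom_eq_top
  let S := AddSubgroup.toZModSubmodule 2 (Subgroup.toAddSubgroup' (H.map (fstHom F)))
  have hS : S = ⊤ := by
    rw [eq_top_iff, ← b.span_eq, Submodule.span_le]
    rintro _ ⟨i, rfl⟩
    exact ⟨_, Subgroup.subset_closure ⟨i, rfl⟩, rfl⟩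
  exact eq_top_iff.mpr fun s _ => hS.ge (Submodule.mem_top : s.toAdd ∈ ⊤)

theorem nonempty_cpow_four_mulEquiv {t : ℕ} (hF : Module.finrank (ZMod 2) F = t) :
    Nonempty (Cpow 4 t ≃* CarryPair F) := by
  have : CharP F 2 := (Algebra.charP_iff (ZMod 2) F 2).mp inferInstance
  refine nonempty_cpow_mulEquiv pow_four_eq_one
    (closure_range_basis (Module.finBasisOfFinrankEq (ZMod 2) F hF)) ?_
  rw [natCard_eq, Module.natCard_eq_pow_finrank (K := ZMod 2), hF, Nat.card_zmod, ← pow_mul,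
    mul_comm, pow_mul]
  rfl

end CarryPair

theorem nonempty_cpow_two_prod_mulEquiv {V : Type*} [AddCommGroup V] [Module (ZMod 2) V]
    [Module.Finite (ZMod 2) V] {r s : ℕ} (hV : Module.finrank (ZMod 2) V = r + s) :
    Nonempty (Cpow 2 r × Cpow 2 s ≃* Multiplicative V) := by
  let e : ((Fin r → ZMod 2) × (Fin s → ZMod 2)) ≃ₗ[ZMod 2] V :=
    LinearEquiv.ofFinrankEq _ _ (by simp [hV])
  exact ⟨((MulEquiv.piMultiplicative _).symm.prodCongr (MulEquiv.piMultiplicative _).symm).trans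
    ((MulEquiv.prodMultiplicative _ _).symm.trans e.toAddEquiv.toMultiplicative)⟩

end Isomorphisms

theorem exists_frobenius_invariant_addChar {F : Type*} [Field F] [Finite F] [Algebra (ZMod 2) F] :
    ∃ χ : AddChar F ℤ, χ ≠ 1 ∧ ∀ s, χ (s ^ 2) = χ s := by
  have : CharP F 2 := (Algebra.charP_iff (ZMod 2) F 2).mp inferInstance
  have := Fintype.ofFinite F
  let ψ : AddChar (ZMod 2) ℤ := AddChar.zmodChar 2 (ζ := -1) rfl
  refine ⟨ψ.compAddMonoidHom (Algebra.trace (ZMod 2) F).toAddMonoidHom, ?_, fun s => ?_⟩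
  · obtain ⟨δ, hδ⟩ := Algebra.trace_surjective (ZMod 2) F 1
    refine AddChar.ne_one_iff.mpr ⟨δ, ?_⟩
    simp [hδ, ψ, AddChar.zmodChar_apply, ZMod.val_one]
  · have htrace := Algebra.trace_eq_of_algEquiv (FiniteField.frobeniusAlgEquiv (ZMod 2) F 2) s
    simpa using congrArg ψ htrace

/-- All the subtractions of natural numbers below are exact, because `2 ≤ t` and `k ≤ t`. -/
theorem theorem6p5 (t k : ℕ) (ht : 2 ≤ t) (hk : 1 ≤ k) (hkt : k ≤ t) :
    ∃ (𝒢 : Type) (_ : Group 𝒢),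
      (∃ φ : Cpow 2 k →* MulAut (Cpow 4 t × Cpow 2 (t - k)),
        Nonempty (𝒢 ≃* (Cpow 4 t × Cpow 2 (t - k)) ⋊[φ] Cpow 2 k)) ∧
      (¬ ∀ a b : 𝒢, a * b = b * a) ∧
      ∃ D : Set 𝒢, IsPartialDifferenceSet D
        (2 ^ (3 * t))
        ((2 ^ (2 * t - 1) - 2 ^ (t - 1)) * (2 ^ t - 1))
        (2 ^ (t - 1) + (2 ^ (2 * t - 1) - 2 ^ (t - 1)) * (2 ^ (t - 1) - 2))
        ((2 ^ (2 * t - 1) - 2 ^ (t - 1)) * (2 ^ (t - 1) - 1)) := by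
  let F := GaloisField 2 t
  have := Fintype.ofFinite F
  classical
  have hF : Module.finrank (ZMod 2) F = t := GaloisField.finrank 2 (by omega)
  obtain ⟨χ, hχ, hsq⟩ := exists_frobenius_invariant_addChar (F := F)
  have hfun := isDennistonFunction_spreadSum hχ hsq
  rw [← Nat.card_eq_fintype_card, GaloisField.card 2 t (by omega)] at hfun
  obtain ⟨e₁⟩ := CarryPair.nonempty_cpow_four_mulEquiv hF
  obtain ⟨e₂⟩ := nonempty_cpow_two_prod_mulEquiv (r := t - k) (s := k) (V := F) (by omega)
  let e := MulEquiv.prodAssoc.trans (e₁.prodCongr e₂)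
  have hpds := (hfun.isPartialDifferenceSet_two_pow ht).preimage_mulEquiv e
  let φ := (invAction (Cpow 4 t × Cpow 2 (t - k))).comp
    (Pi.evalMonoidHom (fun _ => Multiplicative (ZMod 2)) (⟨0, hk⟩ : Fin k))
  obtain ⟨a, ha⟩ := exists_cpow_four_prod_inv_ne (t := t) (by omega) (Cpow 2 (t - k))
  refine ⟨_, inferInstance, ⟨φ, ⟨.refl _⟩⟩, ?_, _,
    hpds.preimage_semidirectProduct φ fun b => invAction_mem_iff (fun x hx => ?_) cpow_two_inv _⟩
  · exact semidirectProduct_not_commutative (b := fun _ => .ofAdd 1) (a := a) ha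
  · rw [Set.mem_preimage, map_inv]
    exact hfun.inv_mem_dennistonSet hx
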